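/- Let $d\ge 4$ be even and identify the vertices of the ring graph on $d$ vertices with $\mathbb Z/d\mathbb Z$, two vertices $u,v$ being neighbours when $u-v\equiv\pm1 \pmod d$. Let $x=(x(n))_{n\in\mathbb Z/d\mathbb Z}$ be a circular stationary Gaussian process: a Gaussian random vector with constant mean and covariance $\Sigma(n,m)=\mathrm{Cov}(x(n),x(m))=\rho(n-m)$ for a function $\rho:\mathbb Z/d\mathbb Z\to\mathbb R$. Write $\|\Sigma\|_{op}$ for the operator norm of $\Sigma$ on Euclidean $\mathbb R^d$ and $\max_{n\ge2}\rho(n)$ for the maximum of $\rho(n)$ over $2\le n\le d-2$. Suppose that neighbouring vertices are the most correlated ones, $\rho(1)>\max_{n\ge2}\rho(n)$ (in particular $\rho(0)>0$), so that the correlation gap $$\Delta=\left(\sqrt{1-\frac{\max_{n\ge2}\rho(n)}{\rho(0)}}-\sqrt{1-\frac{\rho(1)}{\rho(0)}}\right)^2$$ is positive. Let $x_1,\dots,x_N$ be independent random vectors with the law of $x$, and let $\varepsilon>0$. A pairing is a bijection $\pi$ from $\{0,\dots,d-1\}$ to the vertices, which pairs $\pi(2n)$ with $\pi(2n+1)$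 for $0\le n<d/2$. If $$N>\frac{\pi^3}{2\Delta}\,\frac{\|\Sigma\|_{op}}{\rho(0)}\;d\,\bigl(3\log d-\log\varepsilon\bigr)$$ (where $\pi$ is the usual constant), then with probability larger than $1-\varepsilon$ every pairing that minimizes the empirical total variation $$\sum_{i=1}^N\sum_{n=0}^{d/2-1}\bigl|x_i(\pi(2n))-x_i(\pi(2n+1))\bigr|$$ over all pairings is connected, that is, pairs only neighbouring vertices. In particular, when $\rho(0)=1$ this holds as soon as $N>\frac{\pi^3\|\Sigma\|_{op}}{2\Delta}\,d\,(3\log d-\log\varepsilon)$. -/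

import Mathlib

open MeasureTheory ProbabilityTheory

noncomputable section

namespace RingPairing

/-- Two vertices of the ring graph on `ZMod d` are neighbours when they differ by `1` modulo `d`. -/
def Neighbor {d : ℕ} (u v : ZMod d) : Prop :=
  u - v = 1 ∨ v - u = 1

/-- `x : Ω → (ZMod d → ℝ)` is a circular stationary Gaussian process with (constant) mean `c` and
covariance `Cov (x n, x m) = ρ (n - m)`, the lag being taken modulo `d`. -/
structure IsCircularStationaryGaussian {Ω : Type*} [MeasurableSpace Ω] {d : ℕ} [NeZero d]
    (x : Ω → ZMod d → ℝ) (c : ℝ) (ρ : ZMod d → ℝ) (P : Measure Ω) : Prop where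
  gaussian : HasGaussianLaw x P
  mean : ∀ n, ∫ ω, x ω n ∂P = c
  cov : ∀ n m, cov[fun ω => x ω n, fun ω => x ω m; P] = ρ (n - m)

/-- The covariance matrix `Σ (n, m) = ρ (n - m)`. -/
def covMatrix {d : ℕ} (ρ : ZMod d → ℝ) : Matrix (ZMod d) (ZMod d) ℝ :=
  Matrix.circulant ρ

/-- The operator norm of `Σ` on `ℝ^d` with the Euclidean norm. -/
def covOpNorm {d : ℕ} [NeZero d] (ρ : ZMod d → ℝ) : ℝ :=
  ‖Matrix.toEuclideanCLM (𝕜 := ℝ) (covMatrix ρ)‖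

/-- `max_{n ≥ 2} ρ n`: the largest value of `ρ` at the lags between distinct vertices that are not
neighbours. For `4 ≤ d` this is a maximum over a nonempty finite set. -/
def maxFarCorr {d : ℕ} (ρ : ZMod d → ℝ) : ℝ :=
  sSup (ρ '' {n | n ≠ 0 ∧ n ≠ 1 ∧ n ≠ -1})

/-- The correlation gap `Δ`. -/
def corrGap {d : ℕ} (ρ : ZMod d → ℝ) : ℝ :=
  (Real.sqrt (1 - maxFarCorr ρ / ρ 0) - Real.sqrt (1 - ρ 1 / ρ 0)) ^ 2

/-- A pairing of the `d` vertices (`d` even), presented as an enumeration `π` of the vertices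
that pairs `π (2n)` with `π (2n+1)` for `0 ≤ n < d/2`. -/
abbrev Pairing (d : ℕ) := Fin d ≃ ZMod d

namespace Pairing

variable {d : ℕ}

/-- The vertex `π (2n)`. -/
def fst (π : Pairing d) (n : Fin (d / 2)) : ZMod d := π ⟨2 * n, by omega⟩

/-- The vertex `π (2n+1)`. -/
def snd (π : Pairing d) (n : Fin (d / 2)) : ZMod d := π ⟨2 * n + 1, by omega⟩

/-- A pairing is connected when it pairs only neighbouring vertices. -/
def IsConnected (π : Pairing d) : Prop :=
  ∀ n : Fin (d / 2), Neighbor (π.fst n) (π.snd n)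

/-- The empirical total variation of the samples `x 0, …, x (N-1)` along the pairing `π`. -/
def totalVariation {N : ℕ} (x : Fin N → ZMod d → ℝ) (π : Pairing d) : ℝ :=
  ∑ i : Fin N, ∑ n : Fin (d / 2), |x i (π.fst n) - x i (π.snd n)|

/-- `π` minimizes the empirical total variation among all pairings. -/
def IsMinimizer {N : ℕ} (x : Fin N → ZMod d → ℝ) (π : Pairing d) : Prop :=
  ∀ π' : Pairing d, totalVariation x π ≤ totalVariation x π'

end Pairing

end RingPairing

end

/-! Compare every pairing with one connected pairing. Since E|x(u) - x(v)| = (2/√π)√(ρ(0) - ρ(u -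
v)), a pairing with k non-neighbouring pairs has expected total variation larger by at least kτ per
sample, where τ = (2/√π)(√(ρ(0) - max ρ) - √(ρ(0) - ρ(1))) and τ² = 4ρ(0)Δ/π. It can minimize only
if the empirical difference deviates from its mean by at least this gap.

The difference for one sample is a function of a Gaussian vector whose partial derivatives, after
smoothing, are at most 2 in absolute value; the differential thus has variance at most 4d‖Σ‖. The
Maurey–Pisier rotation argument (`lintegral_exp_sub_le_of_hasFDerivAt`) costs a factor π²/4, so the
difference is sub-Gaussian with parameter π²d‖Σ‖. Over N samples the bad event for one pairing has
probability at most exp(-k²A), with A = 2Nρ(0)Δ/(π³d‖Σ‖) (`measureReal_totalVariation_le`).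

The union bound is affordable because a disconnected pairing is determined, as a matching, by its
far pairs alone (`partner_eq_of_farCode_eq`): there are at most d^(2k) cases instead of about
d^(d/2). The hypothesis on N gives d²exp(-A) ≤ ε/d, and summing over 1 ≤ k ≤ d/2 gives at most ε/2.
-/

/-! ### Gaussian concentration by rotation (Maurey–Pisier) -/

section GaussianConcentration

open Real Set

/-- The exponential moment bound for increments passes to uniform limits. -/
lemma lintegral_exp_sub_le_of_approx {E : Type*} [MeasurableSpace E] {μ : Measure E} {f : E → ℝ} {K : ℝ}
    (h : ∀ δ > 0, ∃ g : E → ℝ, (∀ x, |f x - g x| ≤ δ) ∧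
      ∫⁻ p, ENNReal.ofReal (exp (g p.2 - g p.1)) ∂(μ.prod μ) ≤ ENNReal.ofReal (exp K)) :
    ∫⁻ p, ENNReal.ofReal (exp (f p.2 - f p.1)) ∂(μ.prod μ) ≤ ENNReal.ofReal (exp K) := by
  have hδ : ∀ δ > 0, ∫⁻ p, ENNReal.ofReal (exp (f p.2 - f p.1)) ∂(μ.prod μ) ≤
      ENNReal.ofReal (exp (2 * δ + K)) := by
    intro δ hδ
    obtain ⟨g, hg, hgK⟩ := h δ hδ
    calc _ ≤ ∫⁻ p, ENNReal.ofReal (exp (2 * δ)) * ENNReal.ofReal (exp (g p.2 - g p.1))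
          ∂(μ.prod μ) := by
          refine lintegral_mono fun p => ?_
          rw [← ENNReal.ofReal_mul (exp_pos _).le, ← exp_add]
          refine ENNReal.ofReal_le_ofReal (exp_le_exp.2 ?_)
          have h1 := abs_le.1 (hg p.1)
          have h2 := abs_le.1 (hg p.2)
          linarith [h1.1, h2.2]
      _ ≤ ENNReal.ofReal (exp (2 * δ)) * ENNReal.ofReal (exp K) := by
          rw [lintegral_const_mul' _ _ (by simp)]
          gcongr
      _ = _ := by rw [← ENNReal.ofReal_mul (exp_pos _).le, ← exp_add]
  have hlim : Filter.Tendsto (fun δ : ℝ => ENNReal.ofReal (exp (2 * δ + K)))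
      (nhdsWithin 0 (Ioi 0)) (nhds (ENNReal.ofReal (exp K))) := by
    have : Continuous fun δ : ℝ => ENNReal.ofReal (exp (2 * δ + K)) :=
      ENNReal.continuous_ofReal.comp (by fun_prop)
    simpa using (this.tendsto 0).mono_left nhdsWithin_le_nhds
  exact ge_of_tendsto hlim (Filter.eventually_of_mem self_mem_nhdsWithin hδ)

variable {E : Type*} [NormedAddCommGroup E] [NormedSpace ℝ E] [MeasurableSpace E] [BorelSpace E]
  [SecondCountableTopology E] [CompleteSpace E]

/-- The exponential moment of a continuous linear functional under a centered Gaussian measure. -/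
lemma lintegral_exp_dual_of_centered (μ : Measure E) [IsGaussian μ] (hμ : μ[id] = 0)
    (L : StrongDual ℝ E) :
    ∫⁻ y, ENNReal.ofReal (exp (L y)) ∂μ = ENNReal.ofReal (exp (Var[L; μ] / 2)) := by
  have hL : μ[L] = 0 := by
    have := IsGaussian.integral_dual (μ := μ) L
    simp only [id_eq] at hμ
    rw [this, hμ, map_zero]
  have hmap : μ.map L = gaussianReal 0 (Var[L; μ]).toNNReal := by
    rw [IsGaussian.map_eq_gaussianReal L, hL]
  have hmgf := mgf_gaussianReal hmap 1
  have hint : Integrable (fun y => exp (L y)) μ := by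
    have h := integrable_exp_mul_gaussianReal (μ := 0) (v := (Var[L; μ]).toNNReal) 1
    rw [← hmap, integrable_map_measure (by fun_prop) (by fun_prop)] at h
    simpa [Function.comp_def] using h
  rw [← ofReal_integral_eq_lintegral_ofReal hint (ae_of_all _ fun _ => (exp_pos _).le)]
  congr 1
  simp only [mgf, one_mul, zero_add, one_pow, mul_one] at hmgf
  rw [hmgf, coe_toNNReal _ (variance_nonneg _ _)]

/-- Jensen's inequality for the exponential along the quarter circle. -/
lemma exp_integral_quarter_le {h : ℝ → ℝ} (hh : Continuous h) :
    ENNReal.ofReal (exp (∫ θ in (0 : ℝ)..(π / 2), h θ)) ≤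
      ENNReal.ofReal (2 / π) *
        ∫⁻ θ in Ioc 0 (π / 2), ENNReal.ofReal (exp (π / 2 * h θ)) := by
  -- The uniform probability on (0, π/2]: the integral of h is the κ-mean of (π/2)h, which is where
  -- the factor π/2 in the exponent comes from.
  set κ : Measure ℝ := ENNReal.ofReal (2 / π) • volume.restrict (Ioc 0 (π / 2)) with hκ
  have hpi := pi_pos
  have : IsProbabilityMeasure κ := ⟨by
    simp only [hκ, Measure.smul_apply, Measure.restrict_apply MeasurableSet.univ, univ_inter,
      volume_Ioc, smul_eq_mul, sub_zero]
    rw [← ENNReal.ofReal_mul (by positivity)]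
    simp only [ENNReal.ofReal_eq_one]
    field_simp⟩
  have hint : ∀ {g : ℝ → ℝ}, Continuous g → Integrable g κ := fun hg =>
    Integrable.smul_measure hg.integrableOn_Ioc (by simp)
  have key := convexOn_exp.map_integral_le (μ := κ) (f := fun θ => π / 2 * h θ)
    continuous_exp.continuousOn isClosed_univ (by simp) (hint (by fun_prop))
    (hint (by simp only [Function.comp_def]; fun_prop))
  have h1 : ∫ θ, π / 2 * h θ ∂κ = ∫ θ in (0 : ℝ)..(π / 2), h θ := by
    rw [hκ, integral_smul_measure, ENNReal.toReal_ofReal (by positivity), integral_const_mul,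
      intervalIntegral.integral_of_le (by positivity), smul_eq_mul, ← mul_assoc]
    field_simp
  rw [h1] at key
  calc _ ≤ ENNReal.ofReal (∫ θ, exp (π / 2 * h θ) ∂κ) := ENNReal.ofReal_le_ofReal key
    _ = ∫⁻ θ, ENNReal.ofReal (exp (π / 2 * h θ)) ∂κ :=
      ofReal_integral_eq_lintegral_ofReal (hint (by fun_prop)) (ae_of_all _ fun _ => (exp_pos _).le)
    _ = _ := by rw [hκ, lintegral_smul_measure, smul_eq_mul]

/-- The increment of a `C¹` function along the rotation from `p.1` to `p.2`. -/
lemma sub_eq_integral_rotation {E : Type*} [NormedAddCommGroup E] [NormedSpace ℝ E]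
    {f : E → ℝ} {f' : E → StrongDual ℝ E} (hf : ∀ x, HasFDerivAt f (f' x) x)
    (hf' : Continuous f') (p : E × E) :
    f p.2 - f p.1 = ∫ θ in (0 : ℝ)..(π / 2),
      f' (cos θ • p.1 + sin θ • p.2) (-sin θ • p.1 + cos θ • p.2) := by
  have hd (θ : ℝ) : HasDerivAt (fun θ : ℝ => f (cos θ • p.1 + sin θ • p.2))
      (f' (cos θ • p.1 + sin θ • p.2) (-sin θ • p.1 + cos θ • p.2)) θ :=
    (hf (cos θ • p.1 + sin θ • p.2)).comp_hasDerivAt θ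
      (((hasDerivAt_cos θ).smul_const p.1).add ((hasDerivAt_sin θ).smul_const p.2))
  rw [intervalIntegral.integral_eq_sub_of_hasDerivAt (fun θ _ => hd θ)
    (Continuous.intervalIntegrable (by fun_prop) _ _)]
  simp

/-- **Maurey–Pisier inequality**: exponential moments of the increment of a `C¹` function between
two independent samples of a centered Gaussian measure. -/
lemma lintegral_exp_sub_le_of_hasFDerivAt (μ : Measure E) [IsGaussian μ] (hμ : μ[id] = 0)
    {f : E → ℝ} {f' : E → StrongDual ℝ E} (hf : ∀ x, HasFDerivAt f (f' x) x)
    (hf' : Continuous f') {s : ℝ} (hs : ∀ x, Var[f' x; μ] ≤ s) :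
    ∫⁻ p, ENNReal.ofReal (exp (f p.2 - f p.1)) ∂(μ.prod μ) ≤
      ENNReal.ofReal (exp (π ^ 2 / 4 * s / 2)) := by
  have hpi := pi_pos
  let R (θ : ℝ) : E × E →L[ℝ] E × E := ContinuousLinearMap.rotation θ
  let G (p : E × E) : ℝ := f' p.1 p.2
  have hGc : Continuous G := by
    simp only [G]; fun_prop
  have hRc : Continuous fun q : ℝ × (E × E) => R q.1 q.2 := by
    simp only [R, ContinuousLinearMap.rotation_apply]; fun_prop
  have hGRc : Continuous fun q : ℝ × (E × E) => G (R q.1 q.2) := hGc.comp hRc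
  have hpath (p : E × E) : f p.2 - f p.1 = ∫ θ in (0 : ℝ)..(π / 2), G (R θ p) :=
    sub_eq_integral_rotation hf hf' p
  -- The point on the rotated path and its velocity have the joint law of two independent samples.
  -- Given the first, the derivative applied to the second is a centered Gaussian of variance at
  -- most s, and the factor π/2 becomes π²/4.
  have hinv (θ : ℝ) : ∫⁻ p, ENNReal.ofReal (exp (π / 2 * G (R θ p))) ∂(μ.prod μ) ≤
      ENNReal.ofReal (exp (π ^ 2 / 4 * s / 2)) := by
    have hm : Measurable fun p : E × E => ENNReal.ofReal (exp (π / 2 * G p)) := by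
      have := hGc.measurable
      fun_prop
    calc ∫⁻ p, ENNReal.ofReal (exp (π / 2 * G (R θ p))) ∂(μ.prod μ)
        = ∫⁻ p, ENNReal.ofReal (exp (π / 2 * G p)) ∂((μ.prod μ).map (R θ)) :=
          (lintegral_map hm (by fun_prop)).symm
      _ = ∫⁻ x, ∫⁻ y, ENNReal.ofReal (exp (π / 2 * G (x, y))) ∂μ ∂μ := by
          rw [IsGaussian.map_rotation_eq_self hμ, lintegral_prod _ hm.aemeasurable]
      _ ≤ ∫⁻ _, ENNReal.ofReal (exp (π ^ 2 / 4 * s / 2)) ∂μ := by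
          refine lintegral_mono fun x => ?_
          have h := lintegral_exp_dual_of_centered μ hμ ((π / 2) • f' x)
          simp only [FunLike.coe_smul, Pi.smul_apply, smul_eq_mul] at h
          rw [h, variance_smul]
          refine ENNReal.ofReal_le_ofReal (exp_le_exp.2 ?_)
          have := hs x
          nlinarith [mul_le_mul_of_nonneg_left this (by positivity : 0 ≤ π ^ 2 / 4)]
      _ = _ := by simp
  clear_value G R
  calc ∫⁻ p, ENNReal.ofReal (exp (f p.2 - f p.1)) ∂(μ.prod μ)
      ≤ ∫⁻ p, (ENNReal.ofReal (2 / π) *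
        ∫⁻ θ in Ioc 0 (π / 2), ENNReal.ofReal (exp (π / 2 * G (R θ p)))) ∂(μ.prod μ) := by
        refine lintegral_mono fun p => ?_
        rw [hpath p]
        exact exp_integral_quarter_le (hGRc.comp (f := fun θ => (θ, p)) (by fun_prop))
    _ = ENNReal.ofReal (2 / π) * ∫⁻ θ in Ioc 0 (π / 2), ∫⁻ p,
          ENNReal.ofReal (exp (π / 2 * G (R θ p))) ∂(μ.prod μ) := by
        rw [lintegral_const_mul' _ _ (by simp), lintegral_lintegral_swap]
        have hsw : Continuous fun q : (E × E) × ℝ => G (R q.2 q.1) := hGRc.comp continuous_swap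
        have := hsw.measurable
        simp only [Function.uncurry_def]
        fun_prop
    _ ≤ ENNReal.ofReal (2 / π) * ∫⁻ _ in Ioc 0 (π / 2),
          ENNReal.ofReal (exp (π ^ 2 / 4 * s / 2)) := by
        gcongr
        exact hinv _
    _ = _ := by
        rw [lintegral_const, Measure.restrict_apply MeasurableSet.univ, univ_inter, volume_Ioc,
          sub_zero, mul_comm (ENNReal.ofReal (exp _)), ← mul_assoc,
          ← ENNReal.ofReal_mul (by positivity)]
        rw [show 2 / π * (π / 2) = 1 by field_simp]
        simp

end GaussianConcentration

/-! ### From symmetrized to centered exponential moments -/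

/-- A variable whose symmetrization has sub-Gaussian exponential moments is sub-Gaussian. -/
lemma hasSubgaussianMGF_sub_integral_of_lintegral_exp_sub_le {E : Type*} [MeasurableSpace E]
    {μ : Measure E} [IsProbabilityMeasure μ] {f : E → ℝ} (hfm : Measurable f)
    (hfi : Integrable f μ) {c : NNReal}
    (h : ∀ t : ℝ, ∫⁻ p, ENNReal.ofReal (Real.exp (t * f p.2 - t * f p.1)) ∂(μ.prod μ) ≤
      ENNReal.ofReal (Real.exp (c * t ^ 2 / 2))) :
    HasSubgaussianMGF (fun x => f x - ∫ y, f y ∂μ) c μ := by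
  have hfac (t : ℝ) : (∫⁻ x, ENNReal.ofReal (Real.exp (-(t * f x))) ∂μ) *
      ∫⁻ x, ENNReal.ofReal (Real.exp (t * f x)) ∂μ ≤ ENNReal.ofReal (Real.exp (c * t ^ 2 / 2)) := by
    rw [← lintegral_prod_mul (by fun_prop) (by fun_prop)]
    refine le_trans (le_of_eq ?_) (h t)
    refine lintegral_congr fun p => ?_
    rw [← ENNReal.ofReal_mul (Real.exp_pos _).le, ← Real.exp_add]
    ring_nf
  have hpos (t : ℝ) : ∫⁻ x, ENNReal.ofReal (Real.exp (t * f x)) ∂μ ≠ 0 := by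
    rw [Ne, lintegral_eq_zero_iff (by fun_prop)]
    intro h0
    have : ∀ᵐ _ ∂μ, False := by
      filter_upwards [h0] with x hx
      simp only [Pi.zero_apply, ENNReal.ofReal_eq_zero] at hx
      exact absurd (Real.exp_pos _) (not_lt.2 hx)
    rw [Filter.eventually_false_iff_eq_bot, ae_eq_bot] at this
    exact IsProbabilityMeasure.ne_zero μ this
  -- The product of the moments at t and -t is finite and the one at -t is nonzero, so the one at t
  -- cannot be infinite.
  have hint (t : ℝ) : Integrable (fun x => Real.exp (t * f x)) μ := by
    rw [← lintegral_ofReal_ne_top_iff_integrable (by fun_prop)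
      (ae_of_all _ fun _ => (Real.exp_pos _).le)]
    intro htop
    have h1 := hfac t
    have h2 := hpos (-t)
    simp only [neg_mul] at h2
    rw [htop, ENNReal.mul_top h2] at h1
    simp at h1
  have hint' (t : ℝ) : Integrable (fun x => Real.exp (-(t * f x))) μ := by
    simpa using hint (-t)
  have hprod (t : ℝ) : (∫ x, Real.exp (-(t * f x)) ∂μ) * ∫ x, Real.exp (t * f x) ∂μ ≤
      Real.exp (c * t ^ 2 / 2) := by
    have h1 := hfac t
    rw [← ofReal_integral_eq_lintegral_ofReal (hint t) (ae_of_all _ fun _ => (Real.exp_pos _).le),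
      ← ofReal_integral_eq_lintegral_ofReal (hint' t) (ae_of_all _ fun _ => (Real.exp_pos _).le),
      ← ENNReal.ofReal_mul (integral_nonneg fun _ => (Real.exp_pos _).le)] at h1
    exact (ENNReal.ofReal_le_ofReal_iff (Real.exp_pos _).le).1 h1
  set m := ∫ y, f y ∂μ with hm
  have hexp (t x : ℝ) : Real.exp (t * (x - m)) = Real.exp (-(t * m)) * Real.exp (t * x) := by
    rw [← Real.exp_add]; ring_nf
  refine ⟨fun t => ?_, fun t => ?_⟩
  · simp only [hexp]
    exact (hint t).const_mul _
  · simp only [mgf, hexp, integral_const_mul]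
    refine le_trans (mul_le_mul_of_nonneg_right ?_ (integral_nonneg fun _ => (Real.exp_pos _).le))
      (hprod t)
    -- Jensen through the tangent line of exp at the mean: E exp(-tf) ≥ exp(-tm), so in the product
    -- bound this factor can be replaced by exp(-tm), which is exactly the centering.
    have hlow : ∫ x, Real.exp (-(t * m)) * (1 + -(t * (f x - m))) ∂μ ≤
        ∫ x, Real.exp (-(t * f x)) ∂μ := by
      refine integral_mono ?_ (hint' t) fun x => ?_
      · exact ((integrable_const _).add ((hfi.sub (integrable_const _)).const_mul t).neg).const_mul _
      · have : Real.exp (-(t * f x)) = Real.exp (-(t * m)) * Real.exp (-(t * (f x - m))) := by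
          rw [← Real.exp_add]; ring_nf
        simp only [this]
        have := Real.add_one_le_exp (-(t * (f x - m)))
        gcongr
        linarith
    refine le_trans (le_of_eq ?_) hlow
    have hi : Integrable (fun x => t * (f x - m)) μ := (hfi.sub (integrable_const _)).const_mul t
    have h0 : ∫ x, (f x - m) ∂μ = 0 := by
      rw [integral_sub hfi (integrable_const _)]
      simp [← hm]
    rw [integral_const_mul, integral_add (integrable_const _) hi.fun_neg, integral_neg,
      integral_const_mul, h0]
    simp

/-! ### Mean absolute value of a Gaussian -/

/-- The mean of the absolute value of a centered real Gaussian variable. -/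
lemma integral_abs_gaussianReal (v : NNReal) :
    ∫ x, |x| ∂(gaussianReal 0 v) = Real.sqrt (2 * v / Real.pi) := by
  rcases eq_or_ne v 0 with rfl | hv
  · simp
  have hv' : (0 : ℝ) < v := by positivity
  have hpi := Real.pi_pos
  rw [integral_gaussianReal_eq_integral_smul hv]
  -- The integrand as a function of |x| with real powers, ready for folding onto the half-line and
  -- the Gamma integral.
  have h1 : ∀ x : ℝ, gaussianPDFReal 0 v x • |x| =
      (fun y => (Real.sqrt (2 * Real.pi * v))⁻¹ *
        (y ^ (1 : ℝ) * Real.exp (-(2 * (v : ℝ))⁻¹ * y ^ (2 : ℝ)))) |x| := by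
    intro x
    simp only [gaussianPDFReal, smul_eq_mul, sub_zero, Real.rpow_one, Real.rpow_two, sq_abs]
    rw [show -x ^ 2 / (2 * (v : ℝ)) = -(2 * (v : ℝ))⁻¹ * x ^ 2 by ring]
    ring
  rw [integral_congr_ae (ae_of_all _ h1), integral_comp_abs (f := fun y : ℝ =>
    (Real.sqrt (2 * Real.pi * v))⁻¹ *
      (y ^ (1 : ℝ) * Real.exp (-(2 * (v : ℝ))⁻¹ * y ^ (2 : ℝ)))), integral_const_mul,
    integral_rpow_mul_exp_neg_mul_rpow (by norm_num) (by norm_num) (by positivity)]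
  norm_num [Real.rpow_neg_one]
  field_simp
  rw [Real.sq_sqrt hv'.le, Real.sq_sqrt zero_le_two]
  ring

/-! ### Absolute increments along involutions, and their smoothing -/

section SmoothAbs

variable {ι : Type*} [Fintype ι]

/-- The derivative of the smooth approximation `√(u² + δ²)` of the absolute value. -/
lemma hasDerivAt_sqrt_sq_add_sq {δ : ℝ} (hδ : 0 < δ) (u : ℝ) :
    HasDerivAt (fun u => Real.sqrt (u ^ 2 + δ ^ 2)) (u / Real.sqrt (u ^ 2 + δ ^ 2)) u := by
  have h : HasDerivAt (fun u : ℝ => u ^ 2 + δ ^ 2) (2 * u) u := by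
    simpa using (hasDerivAt_pow 2 u).add_const (δ ^ 2)
  convert! h.sqrt (by positivity) using 1
  field_simp

lemma abs_div_sqrt_sq_add_sq_le_one (u δ : ℝ) : |u / Real.sqrt (u ^ 2 + δ ^ 2)| ≤ 1 := by
  rw [abs_div, abs_of_nonneg (Real.sqrt_nonneg _)]
  refine div_le_one_of_le₀ ?_ (Real.sqrt_nonneg _)
  exact Real.abs_le_sqrt (by nlinarith [sq_nonneg δ])

lemma abs_abs_sub_sqrt_le {δ : ℝ} (hδ : 0 < δ) (u : ℝ) :
    |(|u| - Real.sqrt (u ^ 2 + δ ^ 2))| ≤ δ := by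
  have h1 : |u| ≤ Real.sqrt (u ^ 2 + δ ^ 2) := Real.abs_le_sqrt (by nlinarith [sq_nonneg δ])
  have h2 : Real.sqrt (u ^ 2 + δ ^ 2) ≤ |u| + δ := by
    refine Real.sqrt_le_iff.2 ⟨by positivity, ?_⟩
    nlinarith [abs_nonneg u, sq_abs u]
  rw [abs_le]
  constructor <;> linarith

/-- The smoothed half-sum of absolute increments along an involution, and its derivative. -/
lemma hasFDerivAt_sum_sqrt_sub_involutive {σ : ι → ι} (hσ : Function.Involutive σ) {δ : ℝ}
    (hδ : 0 < δ) (x : ι → ℝ) :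
    HasFDerivAt (fun x : ι → ℝ => 2⁻¹ * ∑ v, Real.sqrt ((x v - x (σ v)) ^ 2 + δ ^ 2))
      (∑ v, ((x v - x (σ v)) / Real.sqrt ((x v - x (σ v)) ^ 2 + δ ^ 2)) •
        ContinuousLinearMap.proj (R := ℝ) (φ := fun _ : ι => ℝ) v) x := by
  set D : ι → ℝ := fun v => (x v - x (σ v)) / Real.sqrt ((x v - x (σ v)) ^ 2 + δ ^ 2) with hD
  let pr (v : ι) : (ι → ℝ) →L[ℝ] ℝ := ContinuousLinearMap.proj v
  have h1 (v : ι) : HasFDerivAt (fun x : ι → ℝ => Real.sqrt ((x v - x (σ v)) ^ 2 + δ ^ 2))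
      (D v • (pr v - pr (σ v))) x := by
    have hlin : HasFDerivAt (fun x : ι → ℝ => x v - x (σ v)) (pr v - pr (σ v)) x :=
      (pr v - pr (σ v)).hasFDerivAt
    exact HasDerivAt.comp_hasFDerivAt (h₂ := fun u => Real.sqrt (u ^ 2 + δ ^ 2)) x
      (hasDerivAt_sqrt_sq_add_sq hδ (x v - x (σ v))) hlin
  -- Antisymmetry under σ makes the two ends of each pair contribute equally. This cancels the
  -- factor 1/2 and leaves coefficients bounded by 1 rather than 2.
  have hflip (v : ι) : D (σ v) = -D v := by
    simp only [hD, hσ v]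
    rw [show (x (σ v) - x v) ^ 2 = (x v - x (σ v)) ^ 2 by ring, ← neg_div, neg_sub]
  have hre : ∑ v, D v • pr (σ v) = -∑ v, D v • pr v := by
    rw [← Equiv.sum_comp (hσ.toPerm σ) (fun v => D v • pr (σ v)), ← Finset.sum_neg_distrib]
    refine Finset.sum_congr rfl fun v _ => ?_
    simp only [Function.Involutive.coe_toPerm]
    rw [hflip, hσ v]
    ext y
    simp
  have h2 := (HasFDerivAt.fun_sum (u := Finset.univ) fun v _ => h1 v).const_mul (2⁻¹ : ℝ)
  have h3 : ∑ v, D v • pr v = (2⁻¹ : ℝ) • ∑ v, D v • (pr v - pr (σ v)) := by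
    have h4 : ∑ v, D v • (pr v - pr (σ v)) = ∑ v, D v • pr v + ∑ v, D v • pr v := by
      rw [← sub_neg_eq_add, ← hre, ← Finset.sum_sub_distrib]
      exact Finset.sum_congr rfl fun v _ => smul_sub _ _ _
    rw [h4, ← two_smul ℝ, smul_smul, inv_mul_cancel₀ two_ne_zero, one_smul]
  change HasFDerivAt _ (∑ v, D v • pr v) x
  rw [h3]
  exact h2

/-- Half the sum of the absolute increments along `σ`, minus the one along `τ`. -/
noncomputable def involutionGap (σ τ : ι → ι) (x : ι → ℝ) : ℝ :=
  2⁻¹ * ∑ v, |x v - x (σ v)| - 2⁻¹ * ∑ v, |x v - x (τ v)|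

lemma continuous_involutionGap (σ τ : ι → ι) : Continuous (involutionGap σ τ) := by
  unfold involutionGap; fun_prop

/-- Exponential moments of the increments of `involutionGap` under a centered Gaussian measure. -/
lemma lintegral_exp_involutionGap_sub_le {σ τ : ι → ι} (hσ : Function.Involutive σ)
    (hτ : Function.Involutive τ) (μ : Measure (ι → ℝ)) [IsGaussian μ] (hμ : μ[id] = 0) {s : ℝ}
    (hs : ∀ a : ι → ℝ, (∀ v, |a v| ≤ 2) → Var[fun x => ∑ v, a v * x v; μ] ≤ s) (t : ℝ) :
    ∫⁻ p, ENNReal.ofReal (Real.exp (t * involutionGap σ τ p.2 - t * involutionGap σ τ p.1))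
      ∂(μ.prod μ) ≤ ENNReal.ofReal (Real.exp (Real.pi ^ 2 / 4 * s * t ^ 2 / 2)) := by
  rw [show Real.pi ^ 2 / 4 * s * t ^ 2 / 2 = Real.pi ^ 2 / 4 * (t ^ 2 * s) / 2 by ring]
  refine lintegral_exp_sub_le_of_approx (f := fun x => t * involutionGap σ τ x) fun η hη => ?_
  -- Each half-sum moves by at most half of card ι times δ, so their difference moves by at most
  -- card ι times δ, before the factor t.
  obtain ⟨δ, hδ, hδη⟩ : ∃ δ > 0, |t| * (Fintype.card ι * δ) ≤ η := by
    refine ⟨η / (|t| * Fintype.card ι + 1), by positivity, ?_⟩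
    rw [← mul_assoc, mul_div_assoc', div_le_iff₀ (by positivity)]
    nlinarith [mul_nonneg (abs_nonneg t) (Nat.cast_nonneg (α := ℝ) (Fintype.card ι))]
  let S (σ : ι → ι) (x : ι → ℝ) : ℝ := 2⁻¹ * ∑ v, Real.sqrt ((x v - x (σ v)) ^ 2 + δ ^ 2)
  let D (σ : ι → ι) (x : ι → ℝ) (v : ι) : ℝ :=
    (x v - x (σ v)) / Real.sqrt ((x v - x (σ v)) ^ 2 + δ ^ 2)
  have hDc (σ : ι → ι) (v : ι) : Continuous fun x => D σ x v := by
    refine Continuous.div (by fun_prop) (by fun_prop) fun x => ?_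
    positivity
  have hclose (σ : ι → ι) (x : ι → ℝ) :
      |2⁻¹ * ∑ v, |x v - x (σ v)| - S σ x| ≤ 2⁻¹ * (Fintype.card ι * δ) := by
    simp only [S]
    rw [← mul_sub, ← Finset.sum_sub_distrib, abs_mul, abs_of_pos (by norm_num : (0 : ℝ) < 2⁻¹)]
    gcongr
    refine (Finset.abs_sum_le_sum_abs _ _).trans ?_
    refine (Finset.sum_le_sum fun v _ => abs_abs_sub_sqrt_le hδ _).trans ?_
    simp
  refine ⟨fun x => t * (S σ x - S τ x), fun x => ?_, ?_⟩
  · rw [← mul_sub, abs_mul]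
    refine le_trans ?_ hδη
    gcongr
    have h1 := abs_le.1 (hclose σ x)
    have h2 := abs_le.1 (hclose τ x)
    unfold involutionGap
    rw [abs_le]
    constructor <;> linarith [h1.1, h1.2, h2.1, h2.2]
  · let pr (v : ι) : (ι → ℝ) →L[ℝ] ℝ := ContinuousLinearMap.proj v
    have hder (x : ι → ℝ) : HasFDerivAt (fun x => t * (S σ x - S τ x))
        (t • (∑ v, D σ x v • pr v - ∑ v, D τ x v • pr v)) x :=
      ((hasFDerivAt_sum_sqrt_sub_involutive hσ hδ x).sub
        (hasFDerivAt_sum_sqrt_sub_involutive hτ hδ x)).const_mul t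
    refine lintegral_exp_sub_le_of_hasFDerivAt μ hμ hder ?_ fun x => ?_
    · have := hDc σ
      have := hDc τ
      fun_prop
    -- The bound 2 is 1 + 1, one for each involution.
    · have hv := hs (fun v => D σ x v - D τ x v) fun v => by
        have h1 := abs_le.1 (abs_div_sqrt_sq_add_sq_le_one (x v - x (σ v)) δ)
        have h2 := abs_le.1 (abs_div_sqrt_sq_add_sq_le_one (x v - x (τ v)) δ)
        rw [abs_le]
        constructor <;> simp only [D] <;> linarith [h1.1, h1.2, h2.1, h2.2]
      rw [FunLike.coe_smul, variance_smul]
      refine mul_le_mul_of_nonneg_left (le_trans (le_of_eq ?_) hv) (sq_nonneg t)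
      congr 1
      ext y
      simp [pr, sub_mul]

/-- `involutionGap` is sub-Gaussian under a centered Gaussian measure. -/
lemma hasSubgaussianMGF_involutionGap {σ τ : ι → ι} (hσ : Function.Involutive σ)
    (hτ : Function.Involutive τ) (μ : Measure (ι → ℝ)) [IsGaussian μ] (hμ : μ[id] = 0) {s : NNReal}
    (hs : ∀ a : ι → ℝ, (∀ v, |a v| ≤ 2) → Var[fun x => ∑ v, a v * x v; μ] ≤ s)
    (hi : Integrable (involutionGap σ τ) μ) :
    HasSubgaussianMGF (fun x => involutionGap σ τ x - ∫ y, involutionGap σ τ y ∂μ)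
      (Real.toNNReal (Real.pi ^ 2 / 4) * s) μ := by
  refine hasSubgaussianMGF_sub_integral_of_lintegral_exp_sub_le
    (continuous_involutionGap σ τ).measurable hi fun t => ?_
  rw [NNReal.coe_mul, Real.coe_toNNReal _ (by positivity)]
  exact lintegral_exp_involutionGap_sub_le hσ hτ μ hμ hs t

end SmoothAbs

/-! ### Pairings as involutions, and their far pairs -/

namespace RingPairing

lemma Neighbor.symm {d : ℕ} {u v : ZMod d} (h : Neighbor u v) : Neighbor v u := Or.symm h

namespace Pairing

variable {d : ℕ}

/-- The position paired with a given position. -/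
def flip (hd : Even d) (i : Fin d) : Fin d :=
  if h : (i : ℕ) % 2 = 0 then ⟨i + 1, by have := i.2; rw [Nat.even_iff] at hd; omega⟩
  else ⟨i - 1, by have := i.2; omega⟩

lemma flip_flip (hd : Even d) (i : Fin d) : flip hd (flip hd i) = i := by
  have h (i : Fin d) : (flip hd i : ℕ) = if (i : ℕ) % 2 = 0 then (i : ℕ) + 1 else i - 1 := by
    unfold flip
    split_ifs <;> rfl
  ext
  rw [h, h]
  split_ifs <;> omega

/-- The vertex paired with a given vertex. -/
def partner (hd : Even d) (π : Pairing d) (v : ZMod d) : ZMod d := π (flip hd (π.symm v))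

lemma partner_involutive (hd : Even d) (π : Pairing d) : Function.Involutive (partner hd π) := by
  intro v
  simp [partner, flip_flip]

lemma partner_fst (hd : Even d) (π : Pairing d) (n : Fin (d / 2)) :
    partner hd π (π.fst n) = π.snd n := by
  simp [partner, fst, snd, flip]

lemma partner_snd (hd : Even d) (π : Pairing d) (n : Fin (d / 2)) :
    partner hd π (π.snd n) = π.fst n := by
  rw [← partner_fst hd, partner_involutive]

lemma exists_eq_fst_or_snd (hd : Even d) (π : Pairing d) (v : ZMod d) :
    ∃ n, v = π.fst n ∨ v = π.snd n := by
  obtain ⟨i, rfl⟩ := π.surjective v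
  have := i.2
  rw [Nat.even_iff] at hd
  refine ⟨⟨i / 2, by omega⟩, ?_⟩
  rcases Nat.mod_two_eq_zero_or_one i with h | h
  · left
    simp only [fst]
    congr 1; ext; simp only; omega
  · right
    simp only [snd]
    congr 1; ext; simp only; omega

/-- The even and odd positions enumerate all positions. -/
def halves (hd : Even d) : Fin (d / 2) ⊕ Fin (d / 2) ≃ Fin d where
  toFun := Sum.elim (fun n => ⟨2 * n, by omega⟩) (fun n => ⟨2 * n + 1, by omega⟩)
  invFun i := if (i : ℕ) % 2 = 0 then .inl ⟨i / 2, by have := Nat.even_iff.1 hd; omega⟩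
    else .inr ⟨i / 2, by have := Nat.even_iff.1 hd; omega⟩
  left_inv := by
    rintro (n | n)
    · simp
    · have h1 : (2 * (n : ℕ) + 1) % 2 = 1 := by omega
      have h2 : (2 * (n : ℕ) + 1) / 2 = n := by omega
      simp [h1, h2]
  right_inv i := by
    dsimp only
    split_ifs with h <;> ext <;> simp <;> omega

/-- Summing over all vertices amounts to summing over both ends of all pairs. -/
lemma sum_vertices [NeZero d] (hd : Even d) (π : Pairing d) (g : ZMod d → ℝ) :
    ∑ v, g v = ∑ n, (g (π.fst n) + g (π.snd n)) := by
  rw [← Equiv.sum_comp ((halves hd).trans π), Fintype.sum_sum_type, ← Finset.sum_add_distrib]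
  rfl

/-- The total variation of one sample in terms of the partner involution. -/
lemma sum_abs_eq_half_sum [NeZero d] (hd : Even d) (π : Pairing d) (x : ZMod d → ℝ) :
    ∑ n, |x (π.fst n) - x (π.snd n)| = 2⁻¹ * ∑ v, |x v - x (partner hd π v)| := by
  rw [sum_vertices hd π, Finset.mul_sum]
  refine Finset.sum_congr rfl fun n _ => ?_
  rw [partner_fst, partner_snd, abs_sub_comm (x (π.snd n))]
  ring

open Classical in
/-- The indices of the pairs of non-neighbouring vertices. -/
noncomputable def farPairs (π : Pairing d) : Finset (Fin (d / 2)) :=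
  Finset.univ.filter fun n => ¬ Neighbor (π.fst n) (π.snd n)

lemma mem_farPairs {π : Pairing d} {n : Fin (d / 2)} :
    n ∈ π.farPairs ↔ ¬ Neighbor (π.fst n) (π.snd n) := by
  simp [farPairs]

lemma card_farPairs_le (π : Pairing d) : π.farPairs.card ≤ d / 2 := by
  simpa using Finset.card_le_univ π.farPairs

lemma isConnected_iff_card_farPairs {π : Pairing d} : π.IsConnected ↔ π.farPairs.card = 0 := by
  rw [Finset.card_eq_zero, Finset.eq_empty_iff_forall_notMem]
  simp [mem_farPairs, IsConnected]

/-- The list of the pairs of non-neighbouring vertices. -/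
noncomputable def farCode (π : Pairing d) {k : ℕ} (h : π.farPairs.card = k) (i : Fin k) :
    ZMod d × ZMod d :=
  (π.fst (π.farPairs.orderEmbOfFin h i), π.snd (π.farPairs.orderEmbOfFin h i))

/-- A vertex whose partner is not a neighbour is an entry of the code, and then its partner is
read off the code. -/
lemma not_neighbor_partner_iff (hd : Even d) (π : Pairing d) {k : ℕ} (h : π.farPairs.card = k)
    (v w : ZMod d) : (partner hd π v = w ∧ ¬ Neighbor v (partner hd π v)) ↔
      ∃ i, π.farCode h i = (v, w) ∨ π.farCode h i = (w, v) := by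
  constructor
  · rintro ⟨rfl, hv⟩
    obtain ⟨n, hn⟩ := exists_eq_fst_or_snd hd π v
    have hfar : n ∈ π.farPairs := by
      rw [mem_farPairs]
      rcases hn with rfl | rfl
      · rwa [partner_fst] at hv
      · rw [partner_snd] at hv
        exact fun h => hv h.symm
    obtain ⟨i, hi⟩ : ∃ i, π.farPairs.orderEmbOfFin h i = n := by
      have : n ∈ Set.range (π.farPairs.orderEmbOfFin h) := by
        rw [Finset.range_orderEmbOfFin]; exact hfar
      exact this
    refine ⟨i, ?_⟩
    rcases hn with rfl | rfl
    · left; simp [farCode, hi, partner_fst]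
    · right; simp [farCode, hi, partner_snd]
  · rintro ⟨i, hi⟩
    have hfar := mem_farPairs.1 (Finset.orderEmbOfFin_mem π.farPairs h i)
    simp only [farCode, Prod.mk.injEq] at hi
    rcases hi with ⟨rfl, rfl⟩ | ⟨rfl, rfl⟩
    · rw [partner_fst]
      exact ⟨rfl, hfar⟩
    · rw [partner_snd]
      exact ⟨rfl, fun h => hfar h.symm⟩

/-- A pairing that is not connected is determined, up to the enumeration, by its pairs of
non-neighbouring vertices. -/
lemma partner_eq_of_farCode_eq [NeZero d] (hd : Even d) {π π' : Pairing d} {k : ℕ} (hk : 0 < k)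
    (h : π.farPairs.card = k) (h' : π'.farPairs.card = k) (hc : π.farCode h = π'.farCode h') :
    partner hd π = partner hd π' := by
  have hiff (v w : ZMod d) : (partner hd π v = w ∧ ¬ Neighbor v (partner hd π v)) ↔
      (partner hd π' v = w ∧ ¬ Neighbor v (partner hd π' v)) := by
    rw [not_neighbor_partner_iff hd π h, not_neighbor_partner_iff hd π' h', hc]
  have hfar (v : ZMod d) (hv : ¬ Neighbor v (partner hd π v)) :
      partner hd π v = partner hd π' v := ((hiff v _).1 ⟨rfl, hv⟩).1.symm
  have hfar' (v : ZMod d) (hv : ¬ Neighbor v (partner hd π' v)) :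
      partner hd π v = partner hd π' v := ((hiff v _).2 ⟨rfl, hv⟩).1
  -- Agreement spreads around the ring. If either partner of s + 1 is far, the codes decide;
  -- otherwise both partners lie in {s, s + 2}. If one is s, agreement at s forces the other to be
  -- s; if neither is, both are s + 2.
  have hstep (s : ZMod d) (hs : partner hd π s = partner hd π' s) :
      partner hd π (s + 1) = partner hd π' (s + 1) := by
    by_cases h1 : Neighbor (s + 1) (partner hd π (s + 1))
    swap
    · exact hfar _ h1
    by_cases h2 : Neighbor (s + 1) (partner hd π' (s + 1))
    swap
    · exact hfar' _ h2
    have hback {τ τ' : ZMod d → ZMod d} (hτ : Function.Involutive τ) (hτ' : Function.Involutive τ')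
        (hs : τ s = τ' s) (h : (s + 1) - τ (s + 1) = 1) : τ (s + 1) = τ' (s + 1) := by
      have e : τ (s + 1) = s := by linear_combination -h
      have e2 : τ s = s + 1 := by rw [← e, hτ, e]
      rw [e, ← e2, hs, hτ']
    rcases h1 with h1 | h1
    · exact hback (partner_involutive hd π) (partner_involutive hd π') hs h1
    rcases h2 with h2 | h2
    · exact (hback (partner_involutive hd π') (partner_involutive hd π) hs.symm h2).symm
    · linear_combination h1 - h2
  -- The propagation needs a starting vertex, supplied by an end of a far pair. For k = 0 the claim
  -- fails, since the ring has two connected matchings.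
  obtain ⟨s, hs⟩ : ∃ s, partner hd π s = partner hd π' s := by
    have h3 := mem_farPairs.1 (Finset.orderEmbOfFin_mem π.farPairs h ⟨0, hk⟩)
    exact ⟨π.fst (π.farPairs.orderEmbOfFin h ⟨0, hk⟩), hfar _ (by rwa [partner_fst])⟩
  have hall (j : ℕ) : partner hd π (s + j) = partner hd π' (s + j) := by
    induction j with
    | zero => simpa using hs
    | succ j ih =>
      have := hstep _ ih
      push_cast
      rwa [← add_assoc]
  ext v
  have := hall (v - s).val
  simpa using this

/-- The connected pairing of `2n` with `2n+1`. -/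
def standard (d : ℕ) [NeZero d] : Pairing d where
  toFun i := (i : ℕ)
  invFun v := ⟨v.val, ZMod.val_lt v⟩
  left_inv i := by
    ext
    simp [ZMod.val_natCast, Nat.mod_eq_of_lt i.2]
  right_inv v := by simp

lemma standard_neighbor [NeZero d] (n : Fin (d / 2)) :
    Neighbor ((standard d).fst n) ((standard d).snd n) := by
  right
  simp [standard, fst, snd]

end Pairing

end RingPairing

/-! ### Covariance bounds and mean increments of the process -/

namespace RingPairing

/-- The quadratic form of the covariance matrix is bounded by its operator norm. -/
lemma sum_sum_mul_le_covOpNorm {d : ℕ} [NeZero d] (ρ : ZMod d → ℝ) (a : ZMod d → ℝ) :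
    ∑ u, ∑ v, a u * a v * ρ (u - v) ≤ covOpNorm ρ * ∑ v, a v ^ 2 := by
  let A : EuclideanSpace ℝ (ZMod d) := WithLp.toLp 2 a
  have h1 : ∑ u, ∑ v, a u * a v * ρ (u - v) =
      inner ℝ A (Matrix.toEuclideanCLM (𝕜 := ℝ) (covMatrix ρ) A) := by
    rw [Matrix.inner_toEuclideanCLM]
    simp only [A, covMatrix, Matrix.mulVec, dotProduct, Matrix.circulant_apply,
      Finset.mul_sum]
    refine Finset.sum_congr rfl fun u _ => Finset.sum_congr rfl fun v _ => ?_
    ring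
  have h2 : ∑ v, a v ^ 2 = ‖A‖ ^ 2 := by
    rw [EuclideanSpace.norm_sq_eq]
    simp [A]
  rw [h1, h2]
  calc _ ≤ ‖A‖ * ‖Matrix.toEuclideanCLM (𝕜 := ℝ) (covMatrix ρ) A‖ := real_inner_le_norm _ _
    _ ≤ ‖A‖ * (covOpNorm ρ * ‖A‖) := by
        gcongr
        exact ContinuousLinearMap.le_opNorm _ _
    _ = _ := by ring

/-- Lags between distinct non-neighbouring vertices have correlation at most `maxFarCorr`. -/
lemma le_maxFarCorr {d : ℕ} [NeZero d] (ρ : ZMod d → ℝ) {u v : ZMod d} (huv : u ≠ v)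
    (h : ¬ Neighbor u v) : ρ (u - v) ≤ maxFarCorr ρ := by
  refine le_csSup (Set.toFinite _).bddAbove
    ⟨u - v, ⟨sub_ne_zero.2 huv, fun h1 => h (.inl h1), ?_⟩, rfl⟩
  intro h1
  exact h (.inr (by rw [← neg_sub, h1, neg_neg]))

/-- On a ring with at least four vertices, `0` and `2` are neither equal nor neighbours. -/
lemma two_ne_zero_and_not_neighbor {d : ℕ} (hd : 4 ≤ d) :
    (2 : ZMod d) ≠ 0 ∧ ¬ Neighbor (2 : ZMod d) 0 := by
  have hnd (m : ℕ) (h0 : 0 < m) (hm : m < d) : (m : ZMod d) ≠ 0 := by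
    rw [Ne, ZMod.natCast_eq_zero_iff]
    exact Nat.not_dvd_of_pos_of_lt h0 hm
  refine ⟨by simpa using hnd 2 (by omega) (by omega), ?_⟩
  rintro (h | h)
  · exact hnd 1 (by omega) (by omega) (by push_cast; linear_combination h)
  · exact hnd 3 (by omega) (by omega) (by push_cast; linear_combination -h)

namespace IsCircularStationaryGaussian

variable {Ω : Type*} [MeasurableSpace Ω] {d : ℕ} [NeZero d] {x : Ω → ZMod d → ℝ} {c : ℝ}
  {ρ : ZMod d → ℝ} {P : Measure Ω}

lemma hasGaussianLaw_sub (hx : IsCircularStationaryGaussian x c ρ P) (u v : ZMod d) :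
    HasGaussianLaw (fun ω => x ω u - x ω v) P :=
  hx.gaussian.map_fun ((ContinuousLinearMap.proj u : (ZMod d → ℝ) →L[ℝ] ℝ) -
    ContinuousLinearMap.proj v)

lemma memLp_two (hx : IsCircularStationaryGaussian x c ρ P) (v : ZMod d) :
    MemLp (fun ω => x ω v) 2 P :=
  (hx.gaussian.map_fun (ContinuousLinearMap.proj v : (ZMod d → ℝ) →L[ℝ] ℝ)).memLp_two

lemma corr_neg (hx : IsCircularStationaryGaussian x c ρ P) (n : ZMod d) : ρ (-n) = ρ n := by
  have h1 := hx.cov 0 n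
  have h2 := hx.cov n 0
  rw [covariance_comm] at h2
  simpa using h1.symm.trans h2

lemma variance_eq (hx : IsCircularStationaryGaussian x c ρ P) (v : ZMod d) :
    Var[fun ω => x ω v; P] = ρ 0 := by
  rw [← covariance_self (hx.memLp_two v).aemeasurable, hx.cov, sub_self]

/-- Evenness of ρ makes the two orientations of an edge equivalent. -/
lemma corr_of_neighbor (hx : IsCircularStationaryGaussian x c ρ P) {u v : ZMod d}
    (h : Neighbor u v) : ρ (u - v) = ρ 1 := by
  rcases h with h | h
  · rw [h]
  · rw [← neg_sub, h, hx.corr_neg]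

lemma integrable_abs_sub (hx : IsCircularStationaryGaussian x c ρ P) (u v : ZMod d) :
    Integrable (fun ω => |x ω u - x ω v|) P :=
  (hx.hasGaussianLaw_sub u v).integrable.abs

variable [IsProbabilityMeasure P]

lemma variance_sub_eq (hx : IsCircularStationaryGaussian x c ρ P) (u v : ZMod d) :
    Var[fun ω => x ω u - x ω v; P] = 2 * (ρ 0 - ρ (u - v)) := by
  rw [variance_fun_sub (hx.memLp_two u) (hx.memLp_two v), hx.variance_eq, hx.variance_eq, hx.cov]
  ring

lemma variance_add_eq (hx : IsCircularStationaryGaussian x c ρ P) (u v : ZMod d) :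
    Var[fun ω => x ω u + x ω v; P] = 2 * (ρ 0 + ρ (u - v)) := by
  rw [variance_fun_add (hx.memLp_two u) (hx.memLp_two v), hx.variance_eq, hx.variance_eq, hx.cov]
  ring

lemma corr_le (hx : IsCircularStationaryGaussian x c ρ P) (n : ZMod d) : ρ n ≤ ρ 0 := by
  have h1 := hx.variance_sub_eq n 0
  have h2 := variance_nonneg (fun ω => x ω n - x ω 0) P
  rw [sub_zero] at h1
  linarith

lemma neg_le_corr (hx : IsCircularStationaryGaussian x c ρ P) (n : ZMod d) : -ρ 0 ≤ ρ n := by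
  have h1 := hx.variance_add_eq n 0
  have h2 := variance_nonneg (fun ω => x ω n + x ω 0) P
  rw [sub_zero] at h1
  linarith

/-- The vertex 2 is far from 0, so -ρ(0) ≤ ρ(2) ≤ max ρ < ρ(1) ≤ ρ(0). -/
lemma corr_zero_pos (hx : IsCircularStationaryGaussian x c ρ P) (hd : 4 ≤ d)
    (hρ : maxFarCorr ρ < ρ 1) : 0 < ρ 0 := by
  have h1 := hx.corr_le 1
  have h2 := hx.neg_le_corr 2
  obtain ⟨h3, h4⟩ := two_ne_zero_and_not_neighbor hd
  have h5 := le_maxFarCorr ρ h3 h4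
  rw [sub_zero] at h5
  linarith

/-- The variance of a linear form in a stationary process. -/
lemma variance_sum_le (hx : IsCircularStationaryGaussian x c ρ P) (a : ZMod d → ℝ) :
    Var[fun ω => ∑ v, a v * x ω v; P] ≤ covOpNorm ρ * ∑ v, a v ^ 2 := by
  rw [variance_fun_sum fun v => (hx.memLp_two v).const_mul (a v)]
  refine le_trans (le_of_eq ?_) (sum_sum_mul_le_covOpNorm ρ a)
  refine Finset.sum_congr rfl fun u _ => Finset.sum_congr rfl fun v _ => ?_
  rw [covariance_const_mul_left, covariance_const_mul_right, hx.cov]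
  ring

/-- Test the quadratic form on a basis vector. Together with `corr_zero_pos` this makes the operator
norm positive, so it can be divided by. -/
lemma corr_zero_le_covOpNorm (hx : IsCircularStationaryGaussian x c ρ P) :
    ρ 0 ≤ covOpNorm ρ := by
  have h := hx.variance_sum_le (Pi.single 0 1)
  simpa [Pi.single_apply, hx.variance_eq] using h

/-- The mean absolute increment. -/
lemma integral_abs_sub (hx : IsCircularStationaryGaussian x c ρ P) (u v : ZMod d) :
    ∫ ω, |x ω u - x ω v| ∂P = 2 / Real.sqrt Real.pi * Real.sqrt (ρ 0 - ρ (u - v)) := by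
  have hg := hx.hasGaussianLaw_sub u v
  have hmean : ∫ ω, (x ω u - x ω v) ∂P = 0 := by
    rw [integral_sub ((hx.memLp_two u).integrable one_le_two)
      ((hx.memLp_two v).integrable one_le_two), hx.mean, hx.mean, sub_self]
  have hmap := hg.map_eq_gaussianReal
  rw [hmean, hx.variance_sub_eq] at hmap
  have h1 : ∫ ω, |x ω u - x ω v| ∂P = ∫ y, |y| ∂(P.map fun ω => x ω u - x ω v) :=
    (integral_map hg.aemeasurable (by fun_prop)).symm
  have h0 := hx.corr_le (u - v)
  rw [h1, hmap, integral_abs_gaussianReal, Real.coe_toNNReal _ (by linarith),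
    show 2 * (2 * (ρ 0 - ρ (u - v))) / Real.pi = 2 ^ 2 * (ρ 0 - ρ (u - v)) / Real.pi by ring,
    Real.sqrt_div (by nlinarith), Real.sqrt_mul (by norm_num), Real.sqrt_sq (by norm_num)]
  ring

/-- The centered difference of half-sums of absolute increments along two involutions is
sub-Gaussian. -/
lemma hasSubgaussianMGF_involutionGap (hx : IsCircularStationaryGaussian x c ρ P)
    {σ τ : ZMod d → ZMod d} (hσ : Function.Involutive σ) (hτ : Function.Involutive τ) :
    HasSubgaussianMGF (fun ω => involutionGap σ τ (x ω) - ∫ ω', involutionGap σ τ (x ω') ∂P)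
      (Real.toNNReal (Real.pi ^ 2 * d * covOpNorm ρ)) P := by
  have hxm : AEMeasurable x P := hx.gaussian.aemeasurable
  have hK : 0 ≤ covOpNorm ρ := norm_nonneg _
  -- The rotation argument needs a centered law. As the mean is constant, centering leaves all
  -- increments unchanged.
  let y : Ω → ZMod d → ℝ := fun ω v => x ω v - c
  have hym : AEMeasurable y P := hxm.sub_const (fun _ => c)
  have hgap (ω : Ω) : involutionGap σ τ (y ω) = involutionGap σ τ (x ω) := by
    simp [involutionGap, y]
  let μ : Measure (ZMod d → ℝ) := P.map y
  have hG : IsGaussian μ := by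
    have := hx.gaussian.isGaussian_map
    have h : μ = (P.map x).map (fun z => z - fun _ => c) := by
      rw [AEMeasurable.map_map_of_aemeasurable (by fun_prop) hxm]
      rfl
    rw [h]
    infer_instance
  have hcoord (v : ZMod d) : Integrable (fun ω => x ω v) P :=
    (hx.memLp_two v).integrable one_le_two
  have hμ : μ[id] = 0 := by
    have hid : Integrable (fun z : ZMod d → ℝ => z) μ := IsGaussian.integrable_id
    ext v
    simp only [id_eq, Pi.zero_apply]
    rw [eval_integral (fun i => hid.eval i), integral_map hym (measurable_pi_apply v).aestronglyMeasurable]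
    simp only [y]
    rw [integral_sub (hcoord v) (integrable_const _), hx.mean]
    simp
  have hs (a : ZMod d → ℝ) (ha : ∀ v, |a v| ≤ 2) :
      Var[fun z => ∑ v, a v * z v; μ] ≤ (Real.toNNReal (4 * d * covOpNorm ρ) : NNReal) := by
    rw [Real.coe_toNNReal _ (by positivity), variance_map
      (Continuous.measurable (by fun_prop)).aemeasurable hym]
    have h1 : (fun z : ZMod d → ℝ => ∑ v, a v * z v) ∘ y =
        fun ω => ∑ v, a v * x ω v - ∑ v, a v * c := by
      ext ω
      simp [y, mul_sub]
    rw [h1, variance_sub_const]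
    · refine (hx.variance_sum_le a).trans ?_
      have h2 : ∑ v, a v ^ 2 ≤ ∑ _v : ZMod d, (4 : ℝ) := Finset.sum_le_sum fun v _ => by
        have := abs_le.1 (ha v)
        nlinarith [this.1, this.2]
      simp only [Finset.sum_const, Finset.card_univ, ZMod.card, nsmul_eq_mul] at h2
      nlinarith [mul_le_mul_of_nonneg_left h2 hK]
    · exact (integrable_finsetSum _ fun v _ => (hcoord v).const_mul (a v)).aestronglyMeasurable
  have hmeas := (continuous_involutionGap σ τ).measurable
  have hi : Integrable (involutionGap σ τ) μ := by
    rw [integrable_map_measure hmeas.aestronglyMeasurable hym]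
    simp only [Function.comp_def, hgap]
    exact ((integrable_finsetSum _ fun v _ => hx.integrable_abs_sub v (σ v)).const_mul _).sub
      ((integrable_finsetSum _ fun v _ => hx.integrable_abs_sub v (τ v)).const_mul _)
  have hm := (_root_.hasSubgaussianMGF_involutionGap hσ hτ μ hμ hs hi).of_map hym
  have hint : ∫ z, involutionGap σ τ z ∂μ = ∫ ω, involutionGap σ τ (x ω) ∂P := by
    rw [integral_map hym hmeas.aestronglyMeasurable]
    simp only [hgap]
  have hc : Real.toNNReal (Real.pi ^ 2 / 4) * Real.toNNReal (4 * d * covOpNorm ρ) =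
      Real.toNNReal (Real.pi ^ 2 * d * covOpNorm ρ) := by
    rw [← Real.toNNReal_mul (by positivity)]
    congr 1
    ring
  simpa only [Function.comp_def, hgap, hint, hc] using hm

/-- The mean difference between the total variations of the standard pairing and of `π`. -/
lemma integral_involutionGap_partner_le (hx : IsCircularStationaryGaussian x c ρ P)
    (hd : Even d) (π : Pairing d) :
    ∫ ω, involutionGap (Pairing.partner hd (Pairing.standard d)) (Pairing.partner hd π) (x ω) ∂P ≤
      -(π.farPairs.card * (2 / Real.sqrt Real.pi *
        (Real.sqrt (ρ 0 - maxFarCorr ρ) - Real.sqrt (ρ 0 - ρ 1)))) := by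
  have hsum (π : Pairing d) : Integrable (fun ω => ∑ n, |x ω (π.fst n) - x ω (π.snd n)|) P :=
    integrable_finsetSum _ fun n _ => hx.integrable_abs_sub _ _
  simp only [involutionGap, ← Pairing.sum_abs_eq_half_sum]
  rw [integral_sub (hsum _) (hsum _), integral_finsetSum _ fun n _ => hx.integrable_abs_sub _ _,
    integral_finsetSum _ fun n _ => hx.integrable_abs_sub _ _, ← Finset.sum_sub_distrib]
  simp only [hx.integral_abs_sub, hx.corr_of_neighbor (Pairing.standard_neighbor _)]
  -- A neighbouring pair has the same mean increment as a pair of the standard pairing, so only far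
  -- pairs contribute.
  rw [← Finset.sum_subset (Finset.subset_univ π.farPairs)]
  · rw [← nsmul_eq_mul, ← smul_neg]
    refine Finset.sum_le_card_nsmul _ _ _ fun n hn => ?_
    have hne : π.fst n ≠ π.snd n := by
      simp [Pairing.fst, Pairing.snd]
    have h1 := Real.sqrt_le_sqrt (sub_le_sub_left
      (le_maxFarCorr ρ hne (Pairing.mem_farPairs.1 hn)) (ρ 0))
    have h2 : 0 ≤ 2 / Real.sqrt Real.pi := by positivity
    nlinarith [mul_le_mul_of_nonneg_left h1 h2]
  · intro n _ hn
    rw [Pairing.mem_farPairs, not_not] at hn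
    rw [hx.corr_of_neighbor hn, sub_self]

end IsCircularStationaryGaussian

end RingPairing

/-! ### Tail bound for one pairing and union bound over codes -/

namespace RingPairing

/-- Factoring √ρ(0) out of both roots leaves the correlation gap; this is how Δ enters the exponent.
-/
lemma sq_sqrt_gap_eq {d : ℕ} (ρ : ZMod d → ℝ) (h0 : 0 < ρ 0) :
    (2 / Real.sqrt Real.pi * (Real.sqrt (ρ 0 - maxFarCorr ρ) - Real.sqrt (ρ 0 - ρ 1))) ^ 2 =
      4 / Real.pi * (ρ 0 * corrGap ρ) := by
  have h (r : ℝ) : Real.sqrt (ρ 0 - r) = Real.sqrt (ρ 0) * Real.sqrt (1 - r / ρ 0) := by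
    rw [← Real.sqrt_mul h0.le, mul_sub, mul_one, mul_div_cancel₀ _ h0.ne']
  rw [h, h, ← mul_sub, mul_pow, mul_pow, div_pow, Real.sq_sqrt h0.le,
    Real.sq_sqrt Real.pi_pos.le, corrGap]
  norm_num

variable {Ω Ω' : Type*} [MeasurableSpace Ω] [MeasurableSpace Ω'] {P : Measure Ω}
  {Q : Measure Ω'} [IsProbabilityMeasure Q] {d : ℕ} [NeZero d] {x : Ω' → ZMod d → ℝ} {c : ℝ}
  {ρ : ZMod d → ℝ} {N : ℕ} {X : Fin N → Ω → ZMod d → ℝ}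

/-- The probability that a given pairing with `k` pairs of non-neighbours is at least as good as
the standard connected pairing. -/
lemma measureReal_totalVariation_le (hd : 4 ≤ d) (hd_even : Even d)
    (hx : IsCircularStationaryGaussian x c ρ Q) (hρ : maxFarCorr ρ < ρ 1)
    (hX : ∀ i, IdentDistrib (X i) x P Q) (hX_indep : iIndepFun X P) (hN : 0 < N)
    (π : Pairing d) :
    P.real {ω | Pairing.totalVariation (fun i => X i ω) π ≤
        Pairing.totalVariation (fun i => X i ω) (Pairing.standard d)} ≤
      Real.exp (-((π.farPairs.card : ℝ) ^ 2 *
        (2 * N * (ρ 0 * corrGap ρ) / (Real.pi ^ 3 * d * covOpNorm ρ)))) := by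
  have hpi := Real.pi_pos
  have h0 := hx.corr_zero_pos hd hρ
  have hK : 0 < covOpNorm ρ := h0.trans_le hx.corr_zero_le_covOpNorm
  have hd0 : (0 : ℝ) < d := by positivity
  have hN0 : (0 : ℝ) < N := by positivity
  set τ := 2 / Real.sqrt Real.pi * (Real.sqrt (ρ 0 - maxFarCorr ρ) - Real.sqrt (ρ 0 - ρ 1))
    with hτ
  have hτ0 : 0 ≤ τ := by
    have := Real.sqrt_le_sqrt (sub_le_sub_left hρ.le (ρ 0))
    exact mul_nonneg (by positivity) (by linarith)
  set f := involutionGap (Pairing.partner hd_even (Pairing.standard d))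
    (Pairing.partner hd_even π) with hf
  set m := ∫ ω, f (x ω) ∂Q with hm
  have hmle : m ≤ -(π.farPairs.card * τ) := hx.integral_involutionGap_partner_le hd_even π
  have hfm : Measurable fun z => f z - m :=
    (continuous_involutionGap _ _).measurable.sub_const m
  have hsub (i : Fin N) : HasSubgaussianMGF (fun ω => f (X i ω) - m)
      (Real.toNNReal (Real.pi ^ 2 * d * covOpNorm ρ)) P :=
    (hx.hasSubgaussianMGF_involutionGap (Pairing.partner_involutive hd_even _)
      (Pairing.partner_involutive hd_even π)).congr_identDistrib ((hX i).comp hfm).symm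
  have hind : iIndepFun (fun i ω => f (X i ω) - m) P :=
    hX_indep.comp (fun _ z => f z - m) fun _ => hfm
  have key := HasSubgaussianMGF.measure_sum_ge_le_of_iIndepFun hind
    (s := Finset.univ) (fun i _ => hsub i)
    (ε := N * (π.farPairs.card * τ)) (by positivity)
  have hprob : IsProbabilityMeasure P := hX_indep.isProbabilityMeasure
  -- On the event the sum of the f(X i) is nonnegative, while each mean m is at most -kτ, so the
  -- centered sum is at least Nkτ.
  refine le_trans (measureReal_mono fun ω hω => ?_) (key.trans (le_of_eq ?_))
  · simp only [Set.mem_ofPred_eq] at hω ⊢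
    have hfX : ∑ i, f (X i ω) = Pairing.totalVariation (fun i => X i ω) (Pairing.standard d) -
        Pairing.totalVariation (fun i => X i ω) π := by
      simp only [hf, involutionGap, ← Pairing.sum_abs_eq_half_sum, Finset.sum_sub_distrib]
      rfl
    rw [Finset.sum_sub_distrib, hfX]
    simp only [Finset.sum_const, Finset.card_univ, Fintype.card_fin, nsmul_eq_mul]
    have := mul_le_mul_of_nonneg_left hmle hN0.le
    linarith
  · congr 1
    simp only [Finset.sum_const, Finset.card_univ, Fintype.card_fin, nsmul_eq_mul]
    rw [NNReal.coe_mul, NNReal.coe_natCast, Real.coe_toNNReal _ (by positivity), mul_pow, mul_pow,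
      sq_sqrt_gap_eq ρ h0]
    field_simp
    ring

/-- Union bound over the pairings with exactly `k` pairs of non-neighbours. -/
lemma measureReal_exists_card_farPairs_le (hd_even : Even d) [IsProbabilityMeasure P] {k : ℕ}
    (hk : 0 < k) {p : ℝ} (hp0 : 0 ≤ p)
    (hp : ∀ π : Pairing d, π.farPairs.card = k →
      P.real {ω | Pairing.totalVariation (fun i => X i ω) π ≤
        Pairing.totalVariation (fun i => X i ω) (Pairing.standard d)} ≤ p) :
    P.real {ω | ∃ π : Pairing d, π.farPairs.card = k ∧
        Pairing.totalVariation (fun i => X i ω) π ≤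
        Pairing.totalVariation (fun i => X i ω) (Pairing.standard d)} ≤
      ((d : ℝ) ^ 2) ^ k * p := by
  let B (π : Pairing d) : Set Ω := {ω | Pairing.totalVariation (fun i => X i ω) π ≤
    Pairing.totalVariation (fun i => X i ω) (Pairing.standard d)}
  let C (code : Fin k → ZMod d × ZMod d) : Set Ω :=
    {ω | ∃ π : Pairing d, ∃ h : π.farPairs.card = k, π.farCode h = code ∧ ω ∈ B π}
  have hTV {π π' : Pairing d} (h : Pairing.partner hd_even π = Pairing.partner hd_even π')
      (y : Fin N → ZMod d → ℝ) : Pairing.totalVariation y π = Pairing.totalVariation y π' := by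
    simp only [Pairing.totalVariation, Pairing.sum_abs_eq_half_sum hd_even, h]
  -- All pairings with the same code have the same partner map, hence the same total variation: the
  -- event of a code is that of any one representative, or empty.
  have hC (code : Fin k → ZMod d × ZMod d) : P.real (C code) ≤ p := by
    by_cases hex : ∃ π : Pairing d, ∃ h : π.farPairs.card = k, π.farCode h = code
    · obtain ⟨π, h, hcode⟩ := hex
      refine le_trans (measureReal_mono ?_) (hp π h)
      rintro ω ⟨π', h', hcode', hω⟩
      have := Pairing.partner_eq_of_farCode_eq hd_even hk h h' (hcode.trans hcode'.symm)
      simp only [Set.mem_ofPred_eq]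
      rw [hTV this]
      exact hω
    · have : C code = ∅ := by
        ext ω
        simp only [C, Set.mem_ofPred_eq, Set.mem_empty_iff_false, iff_false]
        rintro ⟨π, h, hcode, -⟩
        exact hex ⟨π, h, hcode⟩
      simpa [this] using hp0
  calc _ ≤ P.real (⋃ code, C code) := by
        refine measureReal_mono ?_
        rintro ω ⟨π, h, hω⟩
        exact Set.mem_iUnion.2 ⟨π.farCode h, π, h, rfl, hω⟩
    _ ≤ ∑ code, P.real (C code) := measureReal_iUnion_fintype_le _
    _ ≤ ∑ _code : Fin k → ZMod d × ZMod d, p := Finset.sum_le_sum fun code _ => hC code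
    _ = _ := by
        simp [ZMod.card, sq]

end RingPairing

/-! ### Summation over the number of far pairs -/

theorem mainTheorem1 {Ω Ω' : Type*} [MeasurableSpace Ω] [MeasurableSpace Ω']
    (P : Measure Ω) [IsProbabilityMeasure P] (Q : Measure Ω') [IsProbabilityMeasure Q]
    (d : ℕ) [NeZero d] (hd : 4 ≤ d) (hd_even : Even d)
    (x : Ω' → ZMod d → ℝ) (c : ℝ) (ρ : ZMod d → ℝ)
    (hx : RingPairing.IsCircularStationaryGaussian x c ρ Q)
    (hρ : RingPairing.maxFarCorr ρ < ρ 1)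
    (hΔ : 0 < RingPairing.corrGap ρ)
    (N : ℕ) (X : Fin N → Ω → ZMod d → ℝ)
    (hX : ∀ i, IdentDistrib (X i) x P Q)
    (hX_indep : iIndepFun X P)
    (ε : ℝ) (hε : 0 < ε)
    (hN : Real.pi ^ 3 * (RingPairing.covOpNorm ρ / ρ 0) / (2 * RingPairing.corrGap ρ)
      * d * (3 * Real.log d - Real.log ε) < N) :
    1 - ε < P.real {ω | ∀ π : RingPairing.Pairing d,
      RingPairing.Pairing.IsMinimizer (fun i => X i ω) π → π.IsConnected} := by
  -- For ε > 1 the claim is trivial. From here on ε ≤ 1 ensures T ≥ 0 and ε/d ≤ 1.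
  rcases lt_or_ge 1 ε with hε1 | hε1
  · exact (sub_neg.2 hε1).trans_le measureReal_nonneg
  have hpi := Real.pi_pos
  have h0 := hx.corr_zero_pos hd hρ
  have hK : 0 < RingPairing.covOpNorm ρ := h0.trans_le hx.corr_zero_le_covOpNorm
  have hd4 : (4 : ℝ) ≤ d := by exact_mod_cast hd
  have hd0 : (0 : ℝ) < d := by linarith
  set T := 3 * Real.log d - Real.log ε with hT
  have hT0 : 0 ≤ T := by
    have h1 := Real.log_nonneg (by linarith : (1 : ℝ) ≤ d)
    have h2 := Real.log_nonpos hε.le hε1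
    linarith
  have hN0 : (0 : ℝ) < N := lt_of_le_of_lt (by positivity) hN
  set A := 2 * N * (ρ 0 * RingPairing.corrGap ρ) /
    (Real.pi ^ 3 * d * RingPairing.covOpNorm ρ) with hA
  have hTA : T ≤ A := by
    rw [hA, le_div_iff₀ (by positivity)]
    rw [mul_div_assoc', div_div, div_mul_eq_mul_div, div_mul_eq_mul_div,
      div_lt_iff₀ (by positivity)] at hN
    linarith
  have hexpT : Real.exp (-T) = ε / (d : ℝ) ^ 3 := by
    rw [hT, neg_sub, Real.exp_sub, Real.exp_log hε,
      show 3 * Real.log d = Real.log ((d : ℝ) ^ 3) by rw [Real.log_pow]; norm_num,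
      Real.exp_log (by positivity)]
  let F (k : ℕ) : Set Ω := {ω | ∃ π : RingPairing.Pairing d, π.farPairs.card = k ∧
        RingPairing.Pairing.totalVariation (fun i => X i ω) π ≤
        RingPairing.Pairing.totalVariation (fun i => X i ω) (RingPairing.Pairing.standard d)}
  have hF (k : ℕ) (hk : 1 ≤ k) : P.real (F k) ≤ ε * (d : ℝ)⁻¹ := by
    have h1 : P.real (F k) ≤ ((d : ℝ) ^ 2) ^ k * Real.exp (-T) ^ k := by
      refine RingPairing.measureReal_exists_card_farPairs_le hd_even hk (by positivity)
        fun π hπ => ?_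
      refine (RingPairing.measureReal_totalVariation_le hd hd_even hx hρ hX hX_indep
        (by exact_mod_cast hN0) π).trans ?_
      rw [hπ, ← hA, ← Real.exp_nat_mul]
      refine Real.exp_le_exp.2 ?_
      have hk1 : (1 : ℝ) ≤ k := by exact_mod_cast hk
      -- Since k ≤ k², each far pair gains a factor exp(-T) = ε/d³ against its d² possible
      -- positions, leaving (ε/d)^k ≤ ε/d.
      have h3 : (k : ℝ) * T ≤ (k : ℝ) ^ 2 * A := by
        have : (k : ℝ) * T ≤ k * A := by gcongr
        have hA0 : 0 ≤ k * A := le_trans (by positivity) this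
        nlinarith
      linarith
    refine h1.trans ?_
    rw [← mul_pow, hexpT, show (d : ℝ) ^ 2 * (ε / (d : ℝ) ^ 3) = ε * (d : ℝ)⁻¹ by field_simp]
    refine pow_le_of_le_one (by positivity) ?_ (by omega)
    rw [← div_eq_mul_inv, div_le_one hd0]
    linarith
  set S : Set Ω := {ω | ∀ π : RingPairing.Pairing d,
      RingPairing.Pairing.IsMinimizer (fun i => X i ω) π → π.IsConnected} with hS
  have hbad : P.real Sᶜ < ε := by
    calc P.real Sᶜ ≤ P.real (⋃ k ∈ Finset.Icc 1 (d / 2), F k) := by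
          refine measureReal_mono (fun ω hω => ?_) (measure_ne_top _ _)
          simp only [hS, Set.mem_compl_iff, Set.mem_ofPred_eq, not_forall] at hω
          obtain ⟨π, hmin, hcon⟩ := hω
          rw [RingPairing.Pairing.isConnected_iff_card_farPairs] at hcon
          simp only [Set.mem_iUnion, Finset.mem_Icc]
          exact ⟨π.farPairs.card, ⟨Nat.pos_of_ne_zero hcon, π.card_farPairs_le⟩, π, rfl,
            hmin _⟩
      _ ≤ ∑ k ∈ Finset.Icc 1 (d / 2), P.real (F k) := measureReal_biUnion_finset_le _ _
      _ ≤ ∑ _k ∈ Finset.Icc 1 (d / 2), ε * (d : ℝ)⁻¹ :=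
          Finset.sum_le_sum fun k hk => hF k (Finset.mem_Icc.1 hk).1
      _ = ((d / 2 : ℕ) : ℝ) * (ε * (d : ℝ)⁻¹) := by simp
      _ ≤ (d : ℝ) / 2 * (ε * (d : ℝ)⁻¹) := by
          gcongr
          exact Nat.cast_div_le
      _ = ε / 2 := by field_simp
      _ < ε := by linarith
  have htot : 1 ≤ P.real S + P.real Sᶜ := by
    have := measureReal_union_le (μ := P) S Sᶜ
    rwa [Set.union_compl_self, probReal_univ] at this
  linarith
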